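/- Let $(A,\mathfrak m)$ be an Artinian local ring with residue field $k=A/\mathfrak m$, and suppose that $A$ contains $k$, that is, the residue map $A\to k$ has a section $k\to A$ which is a ring homomorphism. Let $(A',\mathfrak m')$ be a Noetherian local ring of Krull dimension one which is complete in its $\mathfrak m'$-adic topology, and let $u:A\to A'$ be a regular morphism (that is, $u$ is flat, and for every prime ideal $P$ of $A$ and every finite field extension $K$ of the fraction field of $A/P$ the ring $K\otimes_{A/P}A'/PA'$ is regular) which induces an isomorphism of residue fields $A/\mathfrak m\cong A'/\mathfrak m'$. Then for every $A$-algebra $B$ of finite type, every morphism of $A$-algebras $v:B\to A'$ factors through a smooth $A$-algebra: there are a smooth $A$-algebra $C$ and morphisms of $A$-algebras $B\to C\to A'$ whose composite is $v$. -/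

import Mathlib

universe u v w

open scoped TensorProduct

/-- A morphism `R → S` of Noetherian rings is *regular* if it is flat and has geometrically regular
fibres: for every prime `p` of `R` and every finite field extension `K` of the fraction field
`κ(p)` of `R/p`, the ring `K ⊗_{κ(p)} (κ(p) ⊗_R S) ≅ K ⊗_{R/p} S/pS` is a regular ring.
(A finite extension of `κ(p)` is isomorphic to one in the universe of `R`, so letting `K` range
over that universe is no restriction.) -/
structure IsRegularMorphism (R : Type u) (S : Type v) [CommRing R] [CommRing S] [Algebra R S] :
    Prop where
  flat : Module.Flat R S
  geometricallyRegular_fiber : ∀ (p : Ideal R) [p.IsPrime] (K : Type u) [Field K]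
    [Algebra p.ResidueField K] [FiniteDimensional p.ResidueField K],
    IsRegularRing (K ⊗[p.ResidueField] p.Fiber S)

/-- Any morphism from an Artinian local ring to a nontrivial ring is a local morphism. It follows
that it induces a map of residue fields if its target is local. -/
instance isLocalHom_algebraMap_of_isArtinianRing (R : Type u) (S : Type v) [CommRing R]
    [CommRing S] [Algebra R S] [IsLocalRing R] [IsArtinianRing R] [Nontrivial S] :
    IsLocalHom (algebraMap R S) where
  map_nonunit a ha := by
    by_contra h
    have hn : IsNilpotent a := by
      obtain ⟨n, hn⟩ := IsArtinianRing.isNilpotent_jacobson_bot (R := R)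
      refine ⟨n, ?_⟩
      have h1 : a ∈ Ideal.jacobson (⊥ : Ideal R) := by
        rw [IsLocalRing.jacobson_eq_maximalIdeal _ bot_ne_top]
        exact h
      have h2 := Ideal.pow_mem_pow h1 n
      rw [hn] at h2
      simpa using h2
    exact (hn.map (algebraMap R S)).not_isUnit ha

/-! The closed fibre `A'/𝔪A'` is a regular local ring of dimension at most one, so the maximal ideal
of `A'` is generated by `𝔪A'` and one element `x`. Completeness gives a map `k⟦X⟧ → A'` with `X ↦
x`. Flatness and nilpotence of `𝔪` make the induced map `A ⊗[k] k⟦X⟧ → A'` bijective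
(`IsRegularMorphism.exists_bijective_powerSeries`). The image of `B` involves only finitely many
power series. If these lie in a smooth `k`-subalgebra `C` of `k⟦X⟧`
(`exists_smooth_subalgebra_powerSeries`), then `A ⊗[k] C` is the required algebra.

Finding `C` is a case of Néron desingularization. Cartier operators show that `k((X))` is separable
over `k(X)`, so finitely many series generate a field with a separating transcendence basis `y` and
a primitive element `z`, a root of some `F` with `F'(z) ≠ 0`. This derivative may be divisible by
`X`. Writing `y` and `z` as truncations plus high powers of `X` times new series `u` and `t`, and
dividing the Taylor expansion of `F` by a power of `X`, gives a polynomial `G` over `k[X][u]` with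
`G(t) = 0` and `G'(t)` a unit. As `k[X][u]` is factorial, the relations of `t` form a principal
ideal, and `k[X][u][t]` becomes smooth after inverting a unit of `k⟦X⟧`. -/

section

open scoped Polynomial

/-! ### Simple roots over a factorial ring generate smooth algebras -/

open Polynomial in
/-- Localizing `R[X]/(g)` at a multiple of `g'` gives a formally smooth `R`-algebra. -/
theorem AdjoinRoot.formallySmooth_of_isLocalization_away {R : Type u} [CommRing R] (g : R[X])
    {S : Type u} [CommRing S] [Algebra R S] [Algebra (AdjoinRoot g) S]
    [IsScalarTower R (AdjoinRoot g) S] (s : AdjoinRoot g) [IsLocalization.Away s S]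
    (hs : AdjoinRoot.mk g (derivative g) ∣ s) : Algebra.FormallySmooth R S := by
  refine .of_comp_surjective fun Q _ _ I hI f ↦ ?_
  let f₁ : AdjoinRoot g →ₐ[R] Q ⧸ I := f.comp (IsScalarTower.toAlgHom R (AdjoinRoot g) S)
  obtain ⟨q, hq⟩ := Ideal.Quotient.mk_surjective (f₁ (AdjoinRoot.root g))
  have hnil : ∀ {a b : Q}, a ∈ I → b ∈ I → a * b = 0 := fun {a b} ha hb ↦ by
    have : a * b ∈ I ^ 2 := by rw [pow_two]; exact Ideal.mul_mem_mul ha hb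
    simpa [hI] using this
  have hmk : ∀ p : R[X], Ideal.Quotient.mk I (aeval q p) = f₁ (AdjoinRoot.mk g p) := by
    intro p
    rw [← AdjoinRoot.aeval_eq, ← aeval_algHom_apply f₁, ← hq]
    exact (aeval_algHom_apply (Ideal.Quotient.mkₐ R I) q p).symm
  have hsu : IsUnit (f₁ s) := (IsLocalization.Away.algebraMap_isUnit (S := S) s).map f
  have hgu : IsUnit (aeval q (derivative g)) := by
    apply (IsNilpotent.isUnit_quotient_mk_iff (I := I) ⟨2, hI⟩).mp
    rw [hmk]
    exact isUnit_of_dvd_unit (map_dvd f₁ hs) hsu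
  obtain ⟨d, hd⟩ := hgu
  have hgI : aeval q g ∈ I := by
    rw [← Ideal.Quotient.eq_zero_iff_mem, hmk, AdjoinRoot.mk_self, map_zero]
  -- One Newton step: as `I ^ 2 = 0`, the Taylor expansion of `g` stops at the linear term, and this
  -- correction gives an exact root.
  set j : Q := -(aeval q g * ↑d⁻¹) with hj
  have hjI : j ∈ I := I.neg_mem (I.mul_mem_right _ hgI)
  have hroot : aeval (q + j) g = 0 := by
    have := Polynomial.aeval_add_of_sq_eq_zero g q j (by rw [pow_two]; exact hnil hjI hjI)
    rw [this, ← hd, hj, mul_neg, mul_left_comm, Units.mul_inv, mul_one, add_neg_cancel]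
  let f₂ : AdjoinRoot g →ₐ[R] Q := AdjoinRoot.liftAlgHom g (Algebra.ofId R Q) (q + j) (by
    simpa [aeval_def] using hroot)
  have hf₂ : (Ideal.Quotient.mkₐ R I).comp f₂ = f₁ := by
    refine AdjoinRoot.algHom_ext ?_
    simp [f₂, ← hq, Ideal.Quotient.eq_zero_iff_mem.mpr hjI]
  have hf₂s : IsUnit (f₂ s) := by
    apply (IsNilpotent.isUnit_quotient_mk_iff (I := I) ⟨2, hI⟩).mp
    rw [← hf₂] at hsu
    exact hsu
  let f₃ : S →ₐ[R] Q := IsLocalization.liftAlgHom (M := Submonoid.powers s) (f := f₂) (by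
    rintro ⟨_, n, rfl⟩
    simpa using hf₂s.pow n)
  refine ⟨f₃, ?_⟩
  apply IsLocalization.algHom_ext (Submonoid.powers s)
  refine AlgHom.ext fun a ↦ ?_
  have h₃ : f₃ (algebraMap _ S a) = f₂ a := by simp [f₃]
  exact congr(Ideal.Quotient.mk I $h₃).trans (DFunLike.congr_fun hf₂ a)

open Polynomial in
/-- The ideal of relations of an element `t` of a domain which is algebraic over a unique
factorization domain is principal. -/
theorem Polynomial.exists_ker_aeval_eq_span {R : Type u} {V : Type v} [CommRing R] [IsDomain R]
    [UniqueFactorizationMonoid R] [CommRing V] [IsDomain V] [Algebra R V] [FaithfulSMul R V]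
    (t : V) : ∃ g : R[X], RingHom.ker (aeval t : R[X] →ₐ[R] V) = Ideal.span {g} := by
  classical
  by_cases hbot : RingHom.ker (aeval t : R[X] →ₐ[R] V) = ⊥
  · exact ⟨0, by simpa using hbot⟩
  have hprime : (RingHom.ker (aeval t : R[X] →ₐ[R] V)).IsPrime := RingHom.ker_isPrime _
  obtain ⟨g, hgmem, hg⟩ := hprime.exists_mem_prime_of_ne_bot hbot
  have hgt : aeval t g = 0 := hgmem
  refine ⟨g, le_antisymm (fun h hh ↦ ?_) ((Ideal.span_singleton_le_iff_mem _).mpr hgmem)⟩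
  have hht : aeval t h = 0 := hh
  rw [Ideal.mem_span_singleton]
  have hdeg : g.natDegree ≠ 0 := by
    intro h0
    obtain ⟨a, rfl⟩ := natDegree_eq_zero.mp h0
    rw [aeval_C, FaithfulSMul.algebraMap_eq_zero_iff R V] at hgt
    simp [hgt] at hg
  have hprim : g.IsPrimitive := hg.irreducible.isPrimitive hdeg
  let : NormalizedGCDMonoid R := Classical.choice inferInstance
  let K := FractionRing R
  have hirr : Irreducible (g.map (algebraMap R K)) :=
    (hprim.irreducible_iff_irreducible_map_fraction_map).mp hg.irreducible
  -- By Gauss, divisibility may be tested over `K`. If it failed there, a Bézout relation between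
  -- `g` and `h`, evaluated at `t`, would read `0 = 1`.
  apply hprim.dvd_of_fraction_map_dvd_fraction_map (K := K)
  by_contra hnd
  obtain ⟨a, b, hab⟩ := (hirr.coprime_iff_not_dvd).mpr hnd
  let L := FractionRing V
  let : Algebra K L := FractionRing.liftAlgebra R L
  have := congr(aeval (R := K) (algebraMap V L t) $hab)
  rw [map_add, map_mul, map_mul, aeval_map_algebraMap, aeval_map_algebraMap,
    aeval_algebraMap_apply (R := R), aeval_algebraMap_apply (R := R), hgt, hht] at this
  simp at this

open Polynomial in
/-- A simple root in a domain `V` of a polynomial over a subring `R` which is factorial lies in a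
formally smooth `R`-subalgebra of `V`. -/
theorem exists_subalgebra_formallySmooth_of_isUnit_derivative {R : Type u} {V : Type u}
    [CommRing R] [IsDomain R] [UniqueFactorizationMonoid R] [CommRing V] [IsDomain V] [Algebra R V]
    [FaithfulSMul R V] (t : V) (G : R[X]) (hG : aeval t G = 0)
    (hG' : IsUnit (aeval t (derivative G))) (q : R) (hq : IsUnit (algebraMap R V q)) :
    ∃ C : Subalgebra R V, Algebra.FormallySmooth R C ∧ Algebra.FiniteType R C ∧ t ∈ C ∧
      ∃ c ∈ C, c * algebraMap R V q = 1 := by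
  obtain ⟨g, hg⟩ := Polynomial.exists_ker_aeval_eq_span (R := R) t
  have hgt : aeval t g = 0 := by
    have : g ∈ RingHom.ker (aeval t : R[X] →ₐ[R] V) := hg ▸ Ideal.mem_span_singleton_self g
    exact this
  have hg' : IsUnit (aeval t (derivative g)) := by
    have : G ∈ RingHom.ker (aeval t : R[X] →ₐ[R] V) := hG
    rw [hg, Ideal.mem_span_singleton] at this
    obtain ⟨h, rfl⟩ := this
    rw [derivative_mul, map_add, map_mul, map_mul, hgt, zero_mul, add_zero] at hG'
    exact isUnit_of_mul_isUnit_left hG'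
  let φ : AdjoinRoot g →ₐ[R] V := AdjoinRoot.liftAlgHom g (Algebra.ofId R V) t (by
    simpa [aeval_def] using hgt)
  have hφmk : ∀ p, φ (AdjoinRoot.mk g p) = aeval t p := fun p ↦ by
    rw [← AdjoinRoot.aeval_eq, ← aeval_algHom_apply]
    simp [φ]
  have hφ : Function.Injective φ := by
    rw [injective_iff_map_eq_zero]
    intro a ha
    obtain ⟨p, rfl⟩ := AdjoinRoot.mk_surjective a
    rw [AdjoinRoot.mk_eq_zero, ← Ideal.mem_span_singleton, ← hg]
    rwa [hφmk] at ha
  -- The first factor yields formal smoothness, the second an inverse of `q`; both become units in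
  -- `V`, so the localization still embeds.
  let s : AdjoinRoot g := AdjoinRoot.mk g (derivative g) * algebraMap R _ q
  have hs : IsUnit (φ s) := by
    rw [map_mul, hφmk, AlgHom.commutes]
    exact hg'.mul hq
  have hsm : ∀ y : Submonoid.powers s, IsUnit (φ y) := by
    rintro ⟨_, n, rfl⟩
    simpa using hs.pow n
  let S := Localization.Away s
  let ψ : S →ₐ[R] V := IsLocalization.liftAlgHom (M := Submonoid.powers s) (f := φ) hsm
  have hψ : ∀ a, ψ (algebraMap _ S a) = φ a := fun a ↦ by simp [ψ]
  have hψinj : Function.Injective ψ := by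
    rw [injective_iff_map_eq_zero]
    intro a ha
    obtain ⟨b, m, rfl⟩ := IsLocalization.exists_mk'_eq (Submonoid.powers s) a
    have h1 := IsLocalization.mk'_spec S b m
    have h2 := congr(ψ $h1)
    rw [map_mul, ha, zero_mul, hψ] at h2
    rw [hφ (h2.symm.trans (map_zero φ).symm), IsLocalization.mk'_zero]
  have : Algebra.FormallySmooth R S :=
    AdjoinRoot.formallySmooth_of_isLocalization_away g s (dvd_mul_right _ _)
  have hfin : Algebra.FiniteType (AdjoinRoot g) S :=
    IsLocalization.finiteType_of_monoid_fg (Submonoid.powers s) S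
  have : Algebra.FiniteType R (AdjoinRoot g) :=
    Algebra.FiniteType.of_surjective (AdjoinRoot.mkₐ g) AdjoinRoot.mk_surjective
  have : Algebra.FiniteType R S := Algebra.FiniteType.trans ‹_› hfin
  let e := AlgEquiv.ofInjective ψ hψinj
  refine ⟨ψ.range, .of_equiv e, .equiv ‹_› e, ⟨algebraMap _ S (AdjoinRoot.root g), ?_⟩, ?_⟩
  · have : φ (AdjoinRoot.root g) = t := by simp [φ]
    rw [← this]
    exact hψ _
  · obtain ⟨w, hw⟩ := (isUnit_of_dvd_unit ((algebraMap _ S).map_dvd (Dvd.intro_left _ rfl))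
      (IsLocalization.Away.algebraMap_isUnit (S := S) s) :
        IsUnit (algebraMap _ S (algebraMap R (AdjoinRoot g) q)))
    refine ⟨ψ ↑w⁻¹, ⟨_, rfl⟩, ?_⟩
    have h3 : ψ (algebraMap _ S (algebraMap R (AdjoinRoot g) q)) = algebraMap R V q := by
      rw [hψ, AlgHom.commutes]
    rw [← h3, ← map_mul, ← hw, Units.inv_mul, map_one]

/-! ### Separability of `k((X))` over `k(X)` by Cartier operators -/

section Cartier

variable {k : Type u} [Field k]

/-- The Cartier operator on power series attached to an additive map `μ` and a residue `l`. -/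
noncomputable def PowerSeries.cartier (p l : ℕ) (μ : k →+ k) : PowerSeries k →+ PowerSeries k where
  toFun f := .mk fun m ↦ μ (coeff (p * m + l) f)
  map_zero' := by ext; simp
  map_add' _ _ := by ext; simp

@[simp]
theorem PowerSeries.coeff_cartier (p l m : ℕ) (μ : k →+ k) (f : PowerSeries k) :
    coeff m (cartier p l μ f) = μ (coeff (p * m + l) f) := by
  simp [cartier]

theorem PowerSeries.map_frobenius_expand (p : ℕ) [ExpChar k p] (f : PowerSeries k) :
    (expand p (expChar_ne_zero k p) f).map (frobenius k p) = f ^ p :=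
  MvPowerSeries.map_frobenius_expand p (expChar_ne_zero k p)

theorem PowerSeries.coeff_pow_expChar_mul (p : ℕ) [ExpChar k p] (f : PowerSeries k) (n : ℕ) :
    coeff (p * n) (f ^ p) = coeff n f ^ p := by
  rw [← map_frobenius_expand p, coeff_map, coeff_expand_mul, frobenius_def]

theorem PowerSeries.coeff_pow_expChar_of_not_dvd (p : ℕ) [ExpChar k p] (f : PowerSeries k) {n : ℕ}
    (hn : ¬ p ∣ n) : coeff n (f ^ p) = 0 := by
  rw [← map_frobenius_expand p, coeff_map, coeff_expand_of_not_dvd _ _ _ hn, map_zero]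

/-- Only exponents divisible by `p` occur in `f ^ p`, with `p`-th powers as coefficients, which `μ`
pulls out as their roots. The bound `l < p` ensures that `p * a ≤ p * m + l` forces `a ≤ m`. -/
theorem PowerSeries.cartier_pow_mul {p l : ℕ} [ExpChar k p] (hl : l < p) {μ : k →+ k}
    (hμ : ∀ a b, μ (a ^ p * b) = a * μ b) (f g : PowerSeries k) :
    cartier p l μ (f ^ p * g) = f * cartier p l μ g := by
  ext m
  rw [coeff_cartier, coeff_mul, map_sum, coeff_mul]
  symm
  have hp : 0 < p := expChar_pos k p
  refine Finset.sum_of_injOn (fun x ↦ (p * x.1, p * x.2 + l)) ?_ ?_ ?_ ?_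
  · rintro ⟨a, b⟩ - ⟨c, d⟩ - h
    simp only [Prod.mk.injEq, add_left_inj] at h
    exact Prod.ext (Nat.eq_of_mul_eq_mul_left hp h.1) (Nat.eq_of_mul_eq_mul_left hp h.2)
  · rintro ⟨a, b⟩ h
    have h : a + b = m := Finset.HasAntidiagonal.mem_antidiagonal.mp h
    refine Finset.HasAntidiagonal.mem_antidiagonal.mpr ?_
    rw [← h]
    ring
  · rintro ⟨a, b⟩ h h'
    have h : a + b = p * m + l := Finset.HasAntidiagonal.mem_antidiagonal.mp h
    by_cases ha : p ∣ a
    · exfalso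
      obtain ⟨a, rfl⟩ := ha
      have ham : a ≤ m := by
        by_contra! hlt
        have : p * (m + 1) ≤ p * a := Nat.mul_le_mul_left p hlt
        rw [mul_add] at this
        omega
      obtain ⟨j, rfl⟩ := Nat.exists_eq_add_of_le ham
      refine h' ⟨(a, j), Finset.HasAntidiagonal.mem_antidiagonal.mpr rfl, ?_⟩
      rw [mul_add] at h
      simp only [Prod.mk.injEq, true_and]
      omega
    · rw [coeff_pow_expChar_of_not_dvd p f ha, zero_mul, map_zero]
  · rintro ⟨a, b⟩ h
    rw [coeff_pow_expChar_mul, hμ, coeff_cartier]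

/-- View `k` as a vector space over its subfield of `p`-th powers, take a linear form nonzero at
`a`, and compose with the inverse of Frobenius. -/
theorem exists_frobenius_semilinear_ne_zero (p : ℕ) [ExpChar k p] {a : k} (ha : a ≠ 0) :
    ∃ μ : k →+ k, (∀ b c, μ (b ^ p * c) = b * μ c) ∧ μ a ≠ 0 := by
  let F := (frobenius k p).fieldRange
  obtain ⟨φ, hφ⟩ : ∃ φ : Module.Dual F k, φ a ≠ 0 := by
    by_contra! h
    exact ha ((Module.forall_dual_apply_eq_zero_iff F a).mp h)
  let e : k ≃+* F := RingEquiv.ofBijective (frobenius k p).rangeRestrictField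
    ⟨(frobenius k p).rangeRestrictField.injective, (frobenius k p).rangeRestrictField_bijective.2⟩
  refine ⟨(e.symm : F →+ k).comp φ.toAddMonoidHom, fun b c ↦ ?_, by simpa using hφ⟩
  have h1 : b ^ p * c = e b • c := rfl
  simp [h1]

variable {K L : Type*} [Field K] [Field L] [Algebra k[X] K] [IsFractionRing k[X] K]
  [Algebra (PowerSeries k) L] [IsFractionRing (PowerSeries k) L] [Algebra K L] [Algebra k[X] L]
  [IsScalarTower k[X] K L] [IsScalarTower k[X] (PowerSeries k) L]

variable (k) in
/-- The field of Laurent series is a separable extension of the field of rational functions. -/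
theorem LinearIndependent.pow_expChar_of_powerSeries (p : ℕ) [ExpChar k p] {ι : Type*} {y : ι → L}
    (hy : LinearIndependent K y) : LinearIndependent K (fun i ↦ y i ^ p) := by
  classical
  rw [linearIndependent_iff'] at hy ⊢
  intro s g hg
  obtain ⟨b, hb⟩ := IsLocalization.exist_integer_multiples (nonZeroDivisors k[X]) s g
  obtain ⟨d, hd⟩ := IsLocalization.exist_integer_multiples (nonZeroDivisors (PowerSeries k)) s y
  choose! c hc using hb
  choose! z hz using hd
  have hb0 : algebraMap k[X] K b ≠ 0 := IsFractionRing.to_map_ne_zero_of_mem_nonZeroDivisors b.2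
  have hd0 : algebraMap (PowerSeries k) L d ≠ 0 :=
    IsFractionRing.to_map_ne_zero_of_mem_nonZeroDivisors d.2
  have hmap : ∀ q : k[X], algebraMap (PowerSeries k) L (q : PowerSeries k) =
      algebraMap K L (algebraMap k[X] K q) := fun q ↦ by
    rw [← IsScalarTower.algebraMap_apply k[X] K L,
      IsScalarTower.algebraMap_apply k[X] (PowerSeries k) L]
    rfl
  have hsum : ∑ i ∈ s, z i ^ p * (c i : PowerSeries k) = 0 := by
    apply IsFractionRing.injective (PowerSeries k) L
    rw [map_sum, map_zero]
    calc _ = ∑ i ∈ s, (algebraMap _ L d.1 ^ p * algebraMap K L (algebraMap k[X] K b)) *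
          (g i • y i ^ p) := Finset.sum_congr rfl fun i hi ↦ by
            rw [map_mul, map_pow, hmap, hz i hi, hc i hi, Algebra.smul_def, Algebra.smul_def,
              Algebra.smul_def, map_mul]
            ring
      _ = 0 := by rw [← Finset.mul_sum, hg, mul_zero]
  -- A Cartier operator turns the relation among the `z i ^ p` into one among the `z i`, whose
  -- coefficients are again polynomials; independence of `y` kills them.
  have key : ∀ (l : ℕ) (μ : k →+ k), l < p → (∀ a b, μ (a ^ p * b) = a * μ b) →
      ∀ i ∈ s, PowerSeries.cartier p l μ (c i) = 0 := by
    intro l μ hl hμ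
    have h1 := congr(PowerSeries.cartier p l μ $hsum)
    rw [map_sum, map_zero] at h1
    have hpoly : ∀ i, ∃ q : k[X], (q : PowerSeries k) = PowerSeries.cartier p l μ (c i) :=
      fun i ↦ by
      refine ⟨PowerSeries.trunc ((c i).natDegree + 1) (PowerSeries.cartier p l μ (c i)), ?_⟩
      ext m
      rw [Polynomial.coeff_coe, PowerSeries.coeff_trunc]
      split_ifs with hm
      · rfl
      · rw [PowerSeries.coeff_cartier, Polynomial.coeff_coe,
          Polynomial.coeff_eq_zero_of_natDegree_lt, map_zero]
        have := Nat.le_mul_of_pos_left m (expChar_pos k p)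
        omega
    choose q hq using hpoly
    have h2 : ∑ i ∈ s, algebraMap k[X] K (q i) • y i = 0 := by
      apply (mul_eq_zero_iff_left hd0).mp
      rw [Finset.mul_sum]
      have h3 := congr(algebraMap _ L $h1)
      rw [map_sum, map_zero] at h3
      rw [← h3]
      refine Finset.sum_congr rfl fun i hi ↦ ?_
      rw [PowerSeries.cartier_pow_mul hl hμ, map_mul, ← hq, hmap, hz i hi, Algebra.smul_def,
        Algebra.smul_def]
      ring
    intro i hi
    have h4 := hy s _ h2 i hi
    rw [← hq, (map_eq_zero_iff _ (IsFractionRing.injective k[X] K)).mp h4, Polynomial.coe_zero]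
  intro i hi
  suffices h : c i = 0 by
    have h1 := hc i hi
    rw [h, map_zero, Algebra.smul_def] at h1
    exact (mul_eq_zero.mp h1.symm).resolve_left hb0
  ext n
  rw [Polynomial.coeff_zero]
  by_contra hn
  -- With residue `n % p`, the coefficient of index `n / p` of the Cartier image is `μ` of the
  -- `n`-th coefficient of `c i`.
  obtain ⟨μ, hμ, hμn⟩ := exists_frobenius_semilinear_ne_zero p hn
  have h1 := congr(PowerSeries.coeff (n / p)
    $(key (n % p) μ (Nat.mod_lt _ (expChar_pos k p)) hμ i hi))
  rw [PowerSeries.coeff_cartier, Nat.div_add_mod, Polynomial.coeff_coe, map_zero] at h1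
  exact hμn h1

end Cartier

/-! ### Separating transcendence bases and clearing of denominators -/

theorem AlgebraicIndependent.affine {ι K L : Type*} [Field K] [CommRing L] [Algebra K L]
    {y : ι → L} (hy : AlgebraicIndependent K y) (a b : ι → K) (ha : ∀ i, a i ≠ 0) :
    AlgebraicIndependent K (fun i ↦ algebraMap K L (a i) * y i + algebraMap K L (b i)) := by
  let φ : MvPolynomial ι K →ₐ[K] MvPolynomial ι K :=
    MvPolynomial.aeval fun i ↦ MvPolynomial.C (a i) * MvPolynomial.X i + MvPolynomial.C (b i)
  let ψ : MvPolynomial ι K →ₐ[K] MvPolynomial ι K :=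
    MvPolynomial.aeval fun i ↦ MvPolynomial.C (a i)⁻¹ * (MvPolynomial.X i - MvPolynomial.C (b i))
  have hψφ : ψ.comp φ = AlgHom.id K _ := by
    ext1 i
    simp only [AlgHom.comp_apply, φ, ψ, MvPolynomial.aeval_X, map_add, map_mul,
      MvPolynomial.algHom_C, AlgHom.id_apply, MvPolynomial.algebraMap_eq]
    rw [← mul_assoc, ← MvPolynomial.C_mul, mul_inv_cancel₀ (ha i), MvPolynomial.C_1, one_mul,
      sub_add_cancel]
  have hφ : Function.Injective φ :=
    Function.LeftInverse.injective (g := ψ) fun x ↦ DFunLike.congr_fun hψφ x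
  have hcomp : MvPolynomial.aeval (fun i ↦ algebraMap K L (a i) * y i + algebraMap K L (b i)) =
      (MvPolynomial.aeval y).comp φ := by
    ext1 i
    simp [φ, MvPolynomial.algHom_C]
  rw [algebraicIndependent_iff_injective_aeval, hcomp]
  rw [AlgHom.coe_comp]
  exact Function.Injective.comp hy hφ

/-- Clears denominators when the elements of `F` are only known to become fractions of elements of
`R` inside `K`. It transfers polynomials from a field generated by a transcendence basis to
`k[X][y]`. -/
theorem Polynomial.exists_map_eq_C_mul {R F K : Type*} [CommRing R] [CommRing F] [CommRing K]
    [IsDomain K] (φ : R →+* K) (j : F →+* K) (hφ : ∀ a : F, ∃ q r : R, φ r ≠ 0 ∧ φ r * j a = φ q)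
    (f : F[X]) : ∃ (c : R) (g : R[X]), φ c ≠ 0 ∧ g.map φ = C (φ c) * f.map j := by
  induction f using Polynomial.induction_on' with
  | add f₁ f₂ h₁ h₂ =>
    obtain ⟨c₁, g₁, hc₁, hg₁⟩ := h₁
    obtain ⟨c₂, g₂, hc₂, hg₂⟩ := h₂
    refine ⟨c₁ * c₂, C c₂ * g₁ + C c₁ * g₂, ?_, ?_⟩
    · rw [map_mul]; exact mul_ne_zero hc₁ hc₂
    · simp only [Polynomial.map_add, Polynomial.map_mul, map_C, hg₁, hg₂, map_mul]
      ring
  | monomial n a =>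
    obtain ⟨q, r, hr, h⟩ := hφ a
    exact ⟨r, monomial n q, hr, by rw [map_monomial, map_monomial, C_mul_monomial, h]⟩

/-- Finitely generated subextensions of `k((X))/k(X)` are separably generated. -/
theorem exists_isTranscendenceBasis_isSeparable_of_powerSeries (k : Type*) [Field k]
    {K L : Type*} [Field K] [Field L]
    [Algebra k[X] K] [IsFractionRing k[X] K] [Algebra (PowerSeries k) L]
    [IsFractionRing (PowerSeries k) L] [Algebra K L] [Algebra k[X] L] [IsScalarTower k[X] K L]
    [IsScalarTower k[X] (PowerSeries k) L] (E : IntermediateField K L)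
    [Algebra.EssFiniteType K E] :
    ∃ s : Finset E, IsTranscendenceBasis K ((↑) : s → E) ∧
      Algebra.IsSeparable (IntermediateField.adjoin K (s : Set E)) E := by
  obtain _ | ⟨p, hp, hpk⟩ := CharP.exists' k
  · have : CharZero K := charZero_of_injective_ringHom (f := (algebraMap k[X] K).comp Polynomial.C)
      ((IsFractionRing.injective k[X] K).comp Polynomial.C_injective)
    exact exists_isTranscendenceBasis_and_isSeparable_of_perfectField K E
  · have : ExpChar k p := .prime hp.out
    have : ExpChar K p := expChar_of_injective_ringHom (f := (algebraMap k[X] K).comp Polynomial.C)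
      ((IsFractionRing.injective k[X] K).comp Polynomial.C_injective) p
    -- Mac Lane's criterion: separable generation follows once `p`-th powers preserve linear
    -- independence.
    refine exists_isTranscendenceBasis_and_isSeparable_of_linearIndepOn_pow_of_essFiniteType
      p hp.out fun s hs ↦ ?_
    have h1 := (hs.map' E.val.toLinearMap (LinearMap.ker_eq_bot.mpr E.val.injective))
    have h2 := h1.pow_expChar_of_powerSeries k p
    refine LinearIndependent.of_comp E.val.toLinearMap ?_
    convert h2 using 1
    ext i
    simp

section

variable {k : Type u} [Field k]

variable {K L : Type u} [Field K] [Field L] [Algebra k[X] K] [IsFractionRing k[X] K]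
  [Algebra (PowerSeries k) L] [IsFractionRing (PowerSeries k) L] [Algebra K L] [Algebra k[X] L]
  [IsScalarTower k[X] K L] [IsScalarTower k[X] (PowerSeries k) L]

-- In the discrete valuation ring `k⟦X⟧` every denominator is a unit times a power of `X`. Such a
-- power lies in `k[X]`, so rescaling by it does not change the field generated over `k(X)`.
omit [Algebra k[X] L] [IsScalarTower k[X] (PowerSeries k) L] in
theorem PowerSeries.exists_X_pow_mul_eq_algebraMap (S : Finset L) :
    ∃ e : ℕ, ∀ a ∈ S, ∃ f : PowerSeries k,
      algebraMap (PowerSeries k) L f = algebraMap (PowerSeries k) L (X ^ e) * a := by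
  obtain ⟨d, hd⟩ := IsLocalization.exist_integer_multiples_of_finset
    (nonZeroDivisors (PowerSeries k)) S
  have hd0 : (d : PowerSeries k) ≠ 0 := nonZeroDivisors.ne_zero d.2
  obtain ⟨e, w, hw⟩ := IsDiscreteValuationRing.associated_pow_irreducible hd0 X_irreducible
  refine ⟨e, fun a ha ↦ ?_⟩
  obtain ⟨f, hf⟩ := hd a ha
  refine ⟨w * f, ?_⟩
  rw [map_mul, hf, ← hw, Algebra.smul_def, map_mul]
  ring

variable (K L) in
/-- Up to denominators, finitely many power series lie in `k[X][y, z]` for some elements `y`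
algebraically independent over `k[X]`, and a root `z` of a separable polynomial over `k[X, y]`. -/
theorem PowerSeries.exists_separating_family (S : Finset (PowerSeries k)) :
    ∃ (ι : Type u) (_ : Finite ι) (y : ι → PowerSeries k) (z : PowerSeries k)
      (F : (Algebra.adjoin k[X] (Set.range y))[X]),
      AlgebraicIndependent K (fun i ↦ algebraMap (PowerSeries k) L (y i)) ∧
      Polynomial.aeval z F = 0 ∧ Polynomial.aeval z (Polynomial.derivative F) ≠ 0 ∧
      ∃ q : Algebra.adjoin k[X] (Set.range y), q ≠ 0 ∧ ∀ b ∈ S,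
        ∃ p : (Algebra.adjoin k[X] (Set.range y))[X], q * b = Polynomial.aeval z p := by
  classical
  let V := PowerSeries k
  let E : IntermediateField K L := IntermediateField.adjoin K (algebraMap V L '' S)
  have hinj : Function.Injective (algebraMap V L) := IsFractionRing.injective V L
  have hPL : ∀ f : k[X], algebraMap V L (f : V) = algebraMap K L (algebraMap k[X] K f) := fun f ↦ by
    rw [← IsScalarTower.algebraMap_apply k[X] K L, IsScalarTower.algebraMap_apply k[X] V L]
    rfl
  have : Algebra.EssFiniteType K E := IntermediateField.essFiniteType_iff.mpr
    (IntermediateField.fg_adjoin_of_finite (S.finite_toSet.image _))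
  obtain ⟨s, hs, hsep⟩ := exists_isTranscendenceBasis_isSeparable_of_powerSeries k E
  let E₁ := IntermediateField.adjoin K (s : Set E)
  have : Algebra.EssFiniteType E₁ E := Algebra.EssFiniteType.of_comp K E₁ E
  have : FiniteDimensional E₁ E := Algebra.finite_of_essFiniteType_of_isAlgebraic
  obtain ⟨z₀, hz₀⟩ := Field.exists_primitive_element E₁ E
  obtain ⟨e, he⟩ := PowerSeries.exists_X_pow_mul_eq_algebraMap (k := k) (L := L)
    ((insert z₀ s).image E.val)
  have he' : ∀ a ∈ insert z₀ s, ∃ f : V, algebraMap V L f = algebraMap V L (X ^ e) * (a : L) :=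
    fun a ha ↦ he a (Finset.mem_image_of_mem _ ha)
  obtain ⟨z, hz⟩ := he' z₀ (Finset.mem_insert_self _ _)
  choose! y hy using fun a (ha : a ∈ s) ↦ he' a (Finset.mem_insert_of_mem ha)
  let d : K := algebraMap k[X] K (Polynomial.X ^ e)
  have hd : algebraMap V L (X ^ e) = algebraMap K L d := by
    rw [← hPL, Polynomial.coe_pow, Polynomial.coe_X]
  have hd0 : d ≠ 0 := (map_ne_zero_iff _ (IsFractionRing.injective k[X] K)).mpr
    (pow_ne_zero _ Polynomial.X_ne_zero)
  let R := Algebra.adjoin k[X] (Set.range fun i : s ↦ y i)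
  let φ : R →+* L := (algebraMap V L).comp (algebraMap R V)
  have hφinj : Function.Injective φ := hinj.comp Subtype.val_injective
  have hφP : ∀ f : k[X], φ (algebraMap k[X] R f) = algebraMap K L (algebraMap k[X] K f) := hPL
  let j : E₁ →+* L := (algebraMap E L).comp (algebraMap E₁ E)
  have hfrac : ∀ a : E, a ∈ E₁ → ∃ q r : R, φ r ≠ 0 ∧ φ r * (a : L) = φ q := by
    intro a ha
    induction ha using IntermediateField.adjoin_induction with
    | mem a ha =>
      refine ⟨⟨y a, Algebra.subset_adjoin ⟨⟨a, ha⟩, rfl⟩⟩, algebraMap k[X] R (Polynomial.X ^ e),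
        ?_, ?_⟩
      · rw [hφP]; exact (map_ne_zero _).mpr hd0
      · rw [hφP]; exact ((hy a ha).trans (by rw [hd])).symm
    | algebraMap c =>
      obtain ⟨f, g, hg, rfl⟩ := IsFractionRing.div_surjective (A := k[X]) c
      have hg0 := IsFractionRing.to_map_ne_zero_of_mem_nonZeroDivisors (K := K) hg
      refine ⟨algebraMap k[X] R f, algebraMap k[X] R g, ?_, ?_⟩
      · rw [hφP]; exact (map_ne_zero _).mpr hg0
      · rw [hφP, hφP]
        change algebraMap K L _ * algebraMap K L _ = _
        rw [← map_mul, mul_div_cancel₀ _ hg0]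
    | add a b _ _ ha hb =>
      obtain ⟨q₁, r₁, h₁, h₁'⟩ := ha
      obtain ⟨q₂, r₂, h₂, h₂'⟩ := hb
      refine ⟨r₂ * q₁ + r₁ * q₂, r₁ * r₂, ?_, ?_⟩
      · rw [map_mul]; exact mul_ne_zero h₁ h₂
      · simp only [map_mul, map_add, ← h₁', ← h₂', IntermediateField.coe_add]
        ring
    | inv a _ ha =>
      obtain ⟨q, r, h, h'⟩ := ha
      by_cases ha0 : a = 0
      · exact ⟨0, 1, by simp, by simp [ha0]⟩
      have ha0' : (a : L) ≠ 0 := by simpa using ha0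
      refine ⟨r, q, ?_, ?_⟩
      · rw [← h']; exact mul_ne_zero h ha0'
      · rw [← h', IntermediateField.coe_inv, mul_inv_cancel_right₀ ha0']
    | mul a b _ _ ha hb =>
      obtain ⟨q₁, r₁, h₁, h₁'⟩ := ha
      obtain ⟨q₂, r₂, h₂, h₂'⟩ := hb
      refine ⟨q₁ * q₂, r₁ * r₂, ?_, ?_⟩
      · rw [map_mul]; exact mul_ne_zero h₁ h₂
      · simp only [map_mul, ← h₁', ← h₂', IntermediateField.coe_mul]
        ring
  have hclear := Polynomial.exists_map_eq_C_mul φ j fun a ↦ hfrac a a.2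
  let z₁ : E := algebraMap K E d * z₀
  have hz₁ : ((z₁ : E) : L) = algebraMap V L z := by rw [hz, hd]; rfl
  have heval : ∀ (c : R) (g : R[X]) (f : E₁[X]), g.map φ = Polynomial.C (φ c) * f.map j →
      algebraMap V L (Polynomial.aeval z g) = φ c * (Polynomial.aeval z₁ f : E) := by
    intro c g f h
    have h1 := congr(Polynomial.eval (algebraMap V L z) $h)
    rw [Polynomial.eval_mul, Polynomial.eval_C, Polynomial.eval_map, Polynomial.eval_map,
      ← hz₁] at h1
    have h2 : Polynomial.eval₂ j (z₁ : L) f = (Polynomial.aeval z₁ f : E) :=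
      (Polynomial.hom_eval₂ f (algebraMap E₁ E) (algebraMap E L) z₁).symm
    rw [← h2, ← h1, hz₁]
    exact Polynomial.hom_eval₂ g (algebraMap R V) (algebraMap V L) z
  -- `F` is the minimal polynomial of the rescaled primitive element up to a nonzero constant, so
  -- separability gives `F'(z) ≠ 0`.
  obtain ⟨c, F, hc, hF⟩ := hclear (minpoly E₁ z₁)
  have hF' : (Polynomial.derivative F).map φ =
      Polynomial.C (φ c) * (Polynomial.derivative (minpoly E₁ z₁)).map j := by
    rw [← Polynomial.derivative_map, hF, Polynomial.derivative_C_mul, Polynomial.derivative_map]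
  have hgen : ∀ b : E, ∃ f : E₁[X], Polynomial.aeval z₁ f = b := by
    intro b
    have hz₀int : IsAlgebraic E₁ z₀ := Algebra.IsAlgebraic.isAlgebraic z₀
    have hb : b ∈ (IntermediateField.adjoin E₁ {z₀}).toSubalgebra := by
      rw [hz₀]; trivial
    rw [IntermediateField.adjoin_simple_toSubalgebra_of_isAlgebraic hz₀int,
      Algebra.adjoin_singleton_eq_range_aeval] at hb
    obtain ⟨f, rfl⟩ := hb
    refine ⟨f.comp (Polynomial.C (algebraMap K E₁ d⁻¹) * Polynomial.X), ?_⟩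
    have h1 : algebraMap K E d⁻¹ * z₁ = z₀ := by
      rw [← mul_assoc, ← map_mul, inv_mul_cancel₀ hd0, map_one, one_mul]
    rw [Polynomial.aeval_comp, map_mul, Polynomial.aeval_C, Polynomial.aeval_X,
      ← IsScalarTower.algebraMap_apply K E₁ E, h1]
    rfl
  have hmem : ∀ b ∈ S, ∃ (c : R) (p : R[X]), φ c ≠ 0 ∧ (c : V) * b = Polynomial.aeval z p := by
    intro b hb
    obtain ⟨f, hf⟩ := hgen ⟨algebraMap V L b, IntermediateField.subset_adjoin _ _ ⟨b, hb, rfl⟩⟩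
    obtain ⟨c, p, hc, hp⟩ := hclear f
    refine ⟨c, p, hc, hinj ?_⟩
    rw [heval c p f hp, hf, map_mul]
    rfl
  choose! q p hq hp using hmem
  refine ⟨s, inferInstance, fun i ↦ y i, z, F, ?_, ?_, ?_, ∏ b ∈ S, q b, ?_, fun b hb ↦ ?_⟩
  · have h1 := (hs.1.map' (f := E.val) E.val.injective).affine (fun _ ↦ d) (fun _ ↦ 0)
      fun _ ↦ hd0
    convert h1 using 2 with i
    rw [map_zero, add_zero, hy i i.2, hd]
    rfl
  · apply hinj
    rw [heval c F _ hF, minpoly.aeval, map_zero]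
    simp
  · intro h
    have h1 := heval c _ _ hF'
    rw [h, map_zero, eq_comm, mul_eq_zero] at h1
    refine h1.elim hc fun h2 ↦ ?_
    exact (Algebra.IsSeparable.isSeparable E₁ z₁).aeval_derivative_ne_zero (minpoly.aeval E₁ z₁)
      (by simpa using h2)
  · rw [Finset.prod_ne_zero_iff]
    intro b hb h
    exact hq b hb (by rw [h, map_zero])
  · refine ⟨Polynomial.C (∏ a ∈ S.erase b, q a) * p b, ?_⟩
    rw [map_mul, Polynomial.aeval_C, ← hp b hb, ← Finset.prod_erase_mul S q hb, ← mul_assoc]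
    rfl

end

/-! ### Néron dilatation inside `k⟦X⟧` -/

section

variable {k : Type u} [Field k]

theorem PowerSeries.exists_eq_trunc_add (n : ℕ) (f : PowerSeries k) :
    ∃ g : PowerSeries k, f = ((trunc n f : k[X]) : PowerSeries k) + X ^ n * g := by
  have : X ^ n ∣ f - ((trunc n f : k[X]) : PowerSeries k) := by
    rw [X_pow_dvd_iff]
    intro m hm
    rw [map_sub, Polynomial.coeff_coe, coeff_trunc, if_pos hm, sub_self]
  obtain ⟨g, hg⟩ := this
  exact ⟨g, by rw [← hg]; ring⟩

/-- An element of `k[X][y]` divisible by a small power of `X` in `k⟦X⟧` is so already in `k[X][u]`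
if `y = c + X ^ n * u` with `c` in `k[X]`. -/
theorem PowerSeries.exists_eq_X_pow_mul_of_mem_adjoin {ι : Type*} {n e : ℕ} (he : e ≤ n)
    {y u : ι → PowerSeries k} {c : ι → k[X]} (hy : ∀ i, y i = (c i : PowerSeries k) + X ^ n * u i)
    {r : PowerSeries k} (hr : r ∈ Algebra.adjoin k[X] (Set.range y)) (hd : X ^ e ∣ r) :
    ∃ r' ∈ Algebra.adjoin k[X] (Set.range u), r = X ^ e * r' := by
  have hP : ∀ f : k[X], (f : PowerSeries k) ∈ Algebra.adjoin k[X] (Set.range u) := fun f ↦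
    Subalgebra.algebraMap_mem _ f
  have hX : (X : PowerSeries k) ∈ Algebra.adjoin k[X] (Set.range u) := by
    simpa using hP Polynomial.X
  -- Modulo `X ^ n` the elements of `k[X][y]` are polynomials in `X` alone, and for these
  -- divisibility by `X ^ e` is the same in `k[X]` and in `k⟦X⟧`.
  have key : ∃ f : k[X], ∃ s ∈ Algebra.adjoin k[X] (Set.range u),
      r = (f : PowerSeries k) + X ^ n * s := by
    clear hd
    induction hr using Algebra.adjoin_induction with
    | mem x hx =>
      obtain ⟨i, rfl⟩ := hx
      exact ⟨c i, u i, Algebra.subset_adjoin ⟨i, rfl⟩, hy i⟩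
    | algebraMap f => exact ⟨f, 0, zero_mem _, by rw [mul_zero, add_zero]; rfl⟩
    | add a b _ _ ha hb =>
      obtain ⟨f, s, hs, rfl⟩ := ha
      obtain ⟨g, t, ht, rfl⟩ := hb
      exact ⟨f + g, s + t, add_mem hs ht, by push_cast; ring⟩
    | mul a b _ _ ha hb =>
      obtain ⟨f, s, hs, rfl⟩ := ha
      obtain ⟨g, t, ht, rfl⟩ := hb
      refine ⟨f * g, (f : PowerSeries k) * t + s * (g : PowerSeries k) + X ^ n * (s * t), ?_,
        by push_cast; ring⟩
      exact add_mem (add_mem (mul_mem (hP f) ht) (mul_mem hs (hP g)))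
        (mul_mem (pow_mem hX n) (mul_mem hs ht))
  obtain ⟨f, s, hs, rfl⟩ := key
  have hf : (X : PowerSeries k) ^ e ∣ (f : PowerSeries k) :=
    (dvd_add_left (Dvd.dvd.mul_right (pow_dvd_pow _ he) _)).mp hd
  have hf' : (Polynomial.X : k[X]) ^ e ∣ f := by
    rw [Polynomial.X_pow_dvd_iff]
    rw [X_pow_dvd_iff] at hf
    intro m hm
    simpa using hf m hm
  obtain ⟨g, rfl⟩ := hf'
  refine ⟨(g : PowerSeries k) + X ^ (n - e) * s, add_mem (hP g) (mul_mem (pow_mem hX _) hs), ?_⟩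
  rw [mul_add, ← mul_assoc, ← pow_add, Nat.add_sub_cancel' he]
  push_cast
  ring

variable {K L : Type*} [Field K] [Field L] [Algebra k[X] K] [IsFractionRing k[X] K]
  [Algebra (PowerSeries k) L] [IsFractionRing (PowerSeries k) L] [Algebra K L] [Algebra k[X] L]
  [IsScalarTower k[X] K L] [IsScalarTower k[X] (PowerSeries k) L]

-- Over `k(X)` the `u i` are affine functions of the `y i`. Hence the dilated ring `k[X][u]` is
-- again a polynomial ring, so factorial and smooth.
open Polynomial in
omit [IsFractionRing (PowerSeries k) L] in
theorem AlgebraicIndependent.of_eq_add_X_pow_mul {ι : Type*} {n : ℕ} {y u : ι → PowerSeries k}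
    {c : ι → k[X]} (hy : AlgebraicIndependent K (fun i ↦ algebraMap (PowerSeries k) L (y i)))
    (hu : ∀ i, y i = (c i : PowerSeries k) + PowerSeries.X ^ n * u i) :
    AlgebraicIndependent k[X] u := by
  let d : K := algebraMap k[X] K (X ^ n)
  have hd : d ≠ 0 := (map_ne_zero_iff _ (IsFractionRing.injective k[X] K)).mpr
    (pow_ne_zero _ X_ne_zero)
  have hKL : ∀ f : k[X], algebraMap K L (algebraMap k[X] K f) =
      algebraMap (PowerSeries k) L (f : PowerSeries k) := fun f ↦ by
    rw [← IsScalarTower.algebraMap_apply k[X] K L,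
      IsScalarTower.algebraMap_apply k[X] (PowerSeries k) L]
    rfl
  have h1 := hy.affine (fun _ ↦ d⁻¹) (fun i ↦ -(d⁻¹ * algebraMap k[X] K (c i)))
    fun _ ↦ inv_ne_zero hd
  refine AlgebraicIndependent.of_comp (IsScalarTower.toAlgHom k[X] (PowerSeries k) L)
    (AlgebraicIndependent.restrictScalars (K := K) (IsFractionRing.injective k[X] K) ?_)
  convert h1 using 1
  ext i
  have hdL : algebraMap K L d ≠ 0 := (_root_.map_ne_zero _).mpr hd
  have h2 : algebraMap (PowerSeries k) L (y i) =
      algebraMap K L (algebraMap k[X] K (c i)) +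
        algebraMap K L d * algebraMap (PowerSeries k) L (u i) := by
    conv_lhs => rw [hu i]
    rw [hKL, hKL, map_add, map_mul, Polynomial.coe_pow, Polynomial.coe_X]
  rw [h2, map_neg, map_mul, map_inv₀]
  change algebraMap (PowerSeries k) L (u i) = _
  rw [mul_add, inv_mul_cancel_left₀ hdL]
  ring

end

open Polynomial in
theorem Polynomial.exists_comp_C_add_C_mul_X {R : Type*} [CommRing R] (f : R[X]) (a b : R) :
    ∃ g : R[X], f.comp (C a + C b * X) =
      C (f.eval a) + C (f.derivative.eval a) * (C b * X) + g * (C b * X) ^ 2 := by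
  obtain ⟨g, hg⟩ := (f.map C).binomExpansion (C a) (C b * X)
  refine ⟨g, ?_⟩
  rw [eval_map, derivative_map, eval_map, eval_map, eval₂_at_apply, eval₂_at_apply] at hg
  exact hg

theorem PowerSeries.isUnit_add_X_pow_mul {k : Type*} [Field k] {f g : PowerSeries k} {n : ℕ}
    (hn : 0 < n) (hf : IsUnit f) : IsUnit (f + X ^ n * g) := by
  rw [isUnit_iff_constantCoeff] at hf ⊢
  simpa [hn.ne'] using hf

open Polynomial in
/-- Over a field `k`, any finite set of power series is contained in a smooth `k`-subalgebra of
`k⟦X⟧`. -/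
theorem exists_smooth_subalgebra_powerSeries {k : Type u} [Field k] (S : Finset (PowerSeries k)) :
    ∃ C : Subalgebra k (PowerSeries k), Algebra.Smooth k C ∧ ∀ b ∈ S, b ∈ C := by
  let K := FractionRing k[X]
  let L := FractionRing (PowerSeries k)
  have : FaithfulSMul k[X] L := (faithfulSMul_iff_algebraMap_injective _ _).mpr <| by
    rw [IsScalarTower.algebraMap_eq k[X] (PowerSeries k) L]
    exact (IsFractionRing.injective (PowerSeries k) L).comp (Polynomial.coe_injective k)
  let : Algebra K L := FractionRing.liftAlgebra k[X] L
  obtain ⟨ι, _, y, z, F, hy, hF, hF', q, hq, hS⟩ := PowerSeries.exists_separating_family K L S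
  obtain ⟨x, hx⟩ : ∃ x : PowerSeries k, x = PowerSeries.X := ⟨_, rfl⟩
  have hx0 : x ≠ 0 := hx ▸ PowerSeries.X_ne_zero
  obtain ⟨c, w, hw⟩ := IsDiscreteValuationRing.associated_pow_irreducible hF'
    PowerSeries.X_irreducible
  obtain ⟨e, w', hw'⟩ := IsDiscreteValuationRing.associated_pow_irreducible
    (show (q : PowerSeries k) ≠ 0 by simpa using hq) PowerSeries.X_irreducible
  -- Here `c` and `e` are the orders of `F'(z)` and `q`. Taking `n = c + m + 1` makes `X ^ (2 * n)`
  -- equal to `X ^ (n + c)` times a positive power of `X`, and `e ≤ n` will allow division by `X ^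
  -- e`.
  obtain ⟨m, hem⟩ : ∃ m, e ≤ c + (m + 1) := ⟨e, by omega⟩
  obtain ⟨n, hn⟩ : ∃ n, n = c + (m + 1) := ⟨_, rfl⟩
  rw [← hn] at hem
  have hxn : x ^ n = x ^ c * x ^ (m + 1) := by rw [hn, pow_add]
  rw [← hx] at hw hw'
  -- The `y i` are truncated further than `z`, because the value of `F` at the truncation of `z`
  -- must be divided by `X ^ (n + c)`.
  choose u hu using fun i ↦ PowerSeries.exists_eq_trunc_add (n + c) (y i)
  obtain ⟨t, ht⟩ := PowerSeries.exists_eq_trunc_add n z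
  rw [← hx] at ht
  let R₀ := Algebra.adjoin k[X] (Set.range y)
  let R := Algebra.adjoin k[X] (Set.range u)
  have hdil : ∀ (m : ℕ) (r : PowerSeries k), m ≤ n + c → r ∈ R₀ → x ^ m ∣ r →
      ∃ r' : R, r = x ^ m * r' :=
    fun m r hm hr₀ hr ↦ by
      rw [hx] at hr ⊢
      obtain ⟨r', h, h'⟩ := PowerSeries.exists_eq_X_pow_mul_of_mem_adjoin hm hu hr₀ hr
      exact ⟨⟨r', h⟩, h'⟩
  let xR : R := algebraMap k[X] R Polynomial.X
  have hxR : algebraMap R (PowerSeries k) xR = x := Polynomial.coe_X.trans hx.symm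
  have hxR' : algebraMap R (PowerSeries k) xR = x := hxR
  have hR₀R : R₀ ≤ R := fun r hr ↦ by
    obtain ⟨r', h⟩ := hdil 0 r (Nat.zero_le _) hr (by simp)
    simp only [pow_zero, one_mul] at h
    rw [h]
    exact r'.2
  let j : R₀ →+* R := (Subalgebra.inclusion hR₀R).toRingHom
  have hjV : ∀ (f : R₀[X]) (s : PowerSeries k), aeval s (f.map j) = aeval s f := fun f s ↦ by
    rw [aeval_def, aeval_def, eval₂_map]
    rfl
  let z₀ : R₀ := algebraMap k[X] R₀ (PowerSeries.trunc n z)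
  have hz : algebraMap R (PowerSeries k) (j z₀) + x ^ n * t = z := ht.symm
  have hjz : ∀ f : R₀[X], (f.map j).eval (j z₀) = j (f.eval z₀) := fun f ↦ eval_map_apply j z₀
  -- Taylor expansion at the truncation of `z`
  have hT : ∀ f : R₀[X], ∃ g : R[X], (f.map j).comp (C (j z₀) + C (xR ^ n) * X) =
      C (j (f.eval z₀)) + C (j (f.derivative.eval z₀)) * (C (xR ^ n) * X) +
        g * (C (xR ^ n) * X) ^ 2 := fun f ↦ by
    obtain ⟨g, hg⟩ := exists_comp_C_add_C_mul_X (f.map j) (j z₀) (xR ^ n)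
    refine ⟨g, ?_⟩
    rw [hg, derivative_map, hjz, hjz]
  have hTt : ∀ (f : R₀[X]) (g : R[X]), (f.map j).comp (C (j z₀) + C (xR ^ n) * X) = g →
      aeval z f = aeval t g := by
    rintro f _ rfl
    rw [aeval_comp, ← hjV, map_add, map_mul, aeval_C, aeval_C, aeval_X, map_pow, hxR, hz]
  obtain ⟨g, hg⟩ := hT F
  obtain ⟨g', hg'⟩ := hT (derivative F)
  have hgt := hTt _ _ hg
  have hgt' := hTt _ _ hg'
  simp only [map_add, map_mul, map_pow, aeval_C, aeval_X, hxR', hxn] at hgt hgt'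
  have hw₁ : aeval z (derivative F) = x ^ c * ↑w⁻¹ := (Units.eq_mul_inv_iff_mul_eq w).mpr hw
  have hw₂ : (q : PowerSeries k) = x ^ e * ↑w'⁻¹ := (Units.eq_mul_inv_iff_mul_eq w').mpr hw'
  rw [hF] at hgt
  rw [hw₁] at hgt'
  obtain ⟨b, hb⟩ : ∃ b : R, algebraMap R (PowerSeries k) (j (F.derivative.eval z₀)) = x ^ c * b :=
    hdil c _ (by omega) (F.derivative.eval z₀).2
      ⟨↑w⁻¹ - x ^ (m + 1) *
        (algebraMap R (PowerSeries k) (j (F.derivative.derivative.eval z₀)) * t +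
          aeval t g' * (x ^ c * x ^ (m + 1)) * t ^ 2), by linear_combination -hgt'⟩
  have hbu : IsUnit (b : PowerSeries k) := by
    have h1 := hgt'
    rw [hb] at h1
    have h2 := mul_left_cancel₀ (pow_ne_zero c hx0) (show
      x ^ c * (b : PowerSeries k) = x ^ c * (↑w⁻¹ +
      x ^ (m + 1) * (-(algebraMap R (PowerSeries k) (j (F.derivative.derivative.eval z₀)) * t +
        aeval t g' * (x ^ c * x ^ (m + 1)) * t ^ 2))) by linear_combination -h1)
    rw [h2, hx]
    exact PowerSeries.isUnit_add_X_pow_mul (Nat.succ_pos m) w⁻¹.isUnit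
  obtain ⟨a, ha⟩ : ∃ a : R, algebraMap R (PowerSeries k) (j (F.eval z₀)) = x ^ (n + c) * a := by
    refine hdil (n + c) _ le_rfl (F.eval z₀).2
      ⟨-((b : PowerSeries k) * t + aeval t g * x ^ (m + 1) * t ^ 2), ?_⟩
    rw [hb] at hgt
    rw [pow_add, hxn]
    linear_combination -hgt
  have hξ : ∀ i, ∃ ξ : R, algebraMap R (PowerSeries k) ξ = x ^ i := fun i ↦
    ⟨xR ^ i, by rw [map_pow, hxR']⟩
  obtain ⟨ξ, hξ₁⟩ := hξ (m + 1)
  -- This is `F(z₀ + X ^ n * T) / X ^ (n + c)` in the variable `T`. Its derivative at `t` is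
  -- congruent to the unit `b` modulo `X`.
  let G : R[X] := C a + C b * X + C ξ * (g * X ^ 2)
  have hGt : aeval t G = 0 := by
    apply mul_left_cancel₀ (pow_ne_zero (n + c) hx0)
    rw [hb, ha, pow_add, hxn] at hgt
    simp only [G, map_add, map_mul, map_pow, aeval_C, aeval_X, hξ₁]
    rw [mul_zero, pow_add, hxn, hgt]
    change _ * ((a : PowerSeries k) + b * t + _) = _
    ring
  have hGt' : IsUnit (aeval t (derivative G)) := by
    have h1 : aeval t (derivative (C a + C b * X + C ξ * (g * X ^ 2))) = (b : PowerSeries k) +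
        x ^ (m + 1) * (aeval t (derivative g) * t ^ 2 + 2 * aeval t g * t) := by
      rw [derivative_add, derivative_add]
      simp only [derivative_mul, derivative_C, derivative_X,
        derivative_X_sq, map_add, map_mul, map_pow, map_zero, map_one, aeval_C, aeval_X, hξ₁,
        map_ofNat]
      change 0 + (0 * t + (b : PowerSeries k) * 1) + _ = _
      ring
    rw [h1, hx]
    exact PowerSeries.isUnit_add_X_pow_mul (Nat.succ_pos m) hbu
  obtain ⟨q', hq'⟩ : ∃ q' : R, (q : PowerSeries k) = x ^ e * q' :=
    hdil e _ (by omega) q.2 ⟨_, hw₂⟩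
  have hq'u : IsUnit (algebraMap R (PowerSeries k) q') := by
    have := mul_left_cancel₀ (pow_ne_zero e hx0) (hq'.symm.trans hw₂)
    change IsUnit (q' : PowerSeries k)
    exact this ▸ w'⁻¹.isUnit
  have hu : AlgebraicIndependent k[X] u := hy.of_eq_add_X_pow_mul hu
  let eR : MvPolynomial ι k[X] ≃ₐ[k[X]] R := hu.aevalEquiv
  have : UniqueFactorizationMonoid R := eR.toMulEquiv.uniqueFactorizationMonoid inferInstance
  have : Algebra.FormallySmooth k[X] R := .of_equiv eR
  have : Algebra.FiniteType k[X] R := .equiv inferInstance eR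
  obtain ⟨D, _, _, htD, r, hrD, hr⟩ :=
    exists_subalgebra_formallySmooth_of_isUnit_derivative t G hGt hGt' q' hq'u
  have hDs : Algebra.FormallySmooth k[X] D := .comp k[X] R D
  have hDs' : Algebra.FormallySmooth k D := .comp k k[X] D
  have hDf : Algebra.FiniteType k[X] D := .trans (S := R) ‹_› ‹_›
  have hDf' : Algebra.FiniteType k D := .trans (S := k[X]) inferInstance ‹_›
  refine ⟨(D.restrictScalars k[X]).restrictScalars k, ⟨hDs', ?_⟩, fun b hb ↦ ?_⟩
  · exact Algebra.FinitePresentation.of_finiteType.mp hDf'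
  · change b ∈ D
    obtain ⟨p, hp⟩ := hS b hb
    obtain ⟨h, hh⟩ := hT p
    have hht := hTt _ _ hh
    simp only [map_add, map_mul, map_pow, aeval_C, aeval_X, hxR'] at hht
    obtain ⟨l, hl⟩ := Nat.exists_eq_add_of_le hem
    have hxl : x ^ n = x ^ e * x ^ l := by rw [hl, pow_add]
    rw [← hp, hq', hxl] at hht
    obtain ⟨ξ, hξ₁⟩ := hξ n
    obtain ⟨ξ', hξ₂⟩ := hξ l
    let s : PowerSeries k := algebraMap R (PowerSeries k) (j (p.derivative.eval z₀)) * t +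
      aeval t h * algebraMap R (PowerSeries k) ξ * t ^ 2
    have hs : s ∈ D := by
      have htD' : ∀ f : R[X], aeval t f ∈ D := fun f ↦
        Algebra.adjoin_le (Set.singleton_subset_iff.mpr htD) (aeval_mem_adjoin_singleton R t)
      exact add_mem (mul_mem (D.algebraMap_mem _) htD)
        (mul_mem (mul_mem (htD' h) (D.algebraMap_mem _)) (pow_mem htD 2))
    have hs' : s = algebraMap R (PowerSeries k) (j (p.derivative.eval z₀)) * t +
        aeval t h * (x ^ e * x ^ l) * t ^ 2 := by
      simp only [s, hξ₁, hxl]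
    -- In `q * b = p(z)` the left side and all Taylor terms beyond the constant one are divisible by
    -- `X ^ e`, hence so is the constant one. Dividing puts `q' * b` into `D`, where `q'` is
    -- invertible.
    obtain ⟨p₀, hp₀⟩ : ∃ p₀ : R, algebraMap R (PowerSeries k) (j (p.eval z₀)) = x ^ e * p₀ :=
      hdil e _ (by omega) (p.eval z₀).2
        ⟨(q' : PowerSeries k) * b - x ^ l * s, by rw [hs']; linear_combination -hht⟩
    have h1 : (q' : PowerSeries k) * b = algebraMap R (PowerSeries k) p₀ +
        algebraMap R (PowerSeries k) ξ' * s := by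
      apply mul_left_cancel₀ (pow_ne_zero e hx0)
      rw [hp₀] at hht
      rw [hξ₂, hs']
      change _ = _ * ((p₀ : PowerSeries k) + _)
      linear_combination hht
    have h2 : b = r * ((q' : PowerSeries k) * b) := by
      rw [← mul_assoc]
      exact (one_mul b).symm.trans (congrArg (· * b) hr.symm)
    rw [h2, h1]
    exact mul_mem hrD (add_mem (D.algebraMap_mem _) (mul_mem (D.algebraMap_mem _) hs))

/-! ### The structure of `A'` as `A ⊗[k] k⟦X⟧` -/

open IsLocalRing

/-- Evaluation of power series at an element of an ideal for which the ring is complete. -/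
theorem PowerSeries.exists_algHom_X_eq {k S : Type*} [CommRing k] [CommRing S] [Algebra k S]
    (I : Ideal S) [IsAdicComplete I S] {x : S} (hx : x ∈ I) :
    ∃ ψ : PowerSeries k →ₐ[k] S, ψ X = x := by
  have htr : ∀ (n : ℕ) (p : k[X]),
      Ideal.Quotient.mk (I ^ n) (Polynomial.aeval x (trunc n (p : PowerSeries k))) =
      Ideal.Quotient.mk (I ^ n) (Polynomial.aeval x p) := by
    intro n p
    have h : (Polynomial.X : k[X]) ^ n ∣ trunc n (p : PowerSeries k) - p := by
      rw [Polynomial.X_pow_dvd_iff]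
      intro m hm
      simp [coeff_trunc, hm]
    obtain ⟨q, hq⟩ := h
    rw [Ideal.Quotient.eq, ← map_sub, hq, map_mul, map_pow, Polynomial.aeval_X]
    exact Ideal.mul_mem_right _ _ (Ideal.pow_mem_pow hx n)
  let F (n : ℕ) : PowerSeries k →ₐ[k] S ⧸ I ^ n := AlgHom.ofLinearMap
    ((Ideal.Quotient.mkₐ k (I ^ n)).toLinearMap ∘ₗ (Polynomial.aeval x).toLinearMap ∘ₗ trunc n)
    (by simpa using htr n 1)
    (fun f g ↦ by
      change Ideal.Quotient.mk (I ^ n) _ = Ideal.Quotient.mk (I ^ n) _ * Ideal.Quotient.mk (I ^ n) _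
      rw [← map_mul]
      change _ = Ideal.Quotient.mk (I ^ n)
        (Polynomial.aeval x (trunc n f) * Polynomial.aeval x (trunc n g))
      rw [← map_mul (Polynomial.aeval x), ← htr n (_ * _), Polynomial.coe_mul,
        trunc_trunc_mul_trunc]
      rfl)
  have hF : ∀ n f, F n f = Ideal.Quotient.mk (I ^ n) (Polynomial.aeval x (trunc n f)) :=
    fun _ _ ↦ rfl
  have hcomp : ∀ {m n : ℕ} (hle : m ≤ n),
      (Ideal.Quotient.factorₐ k (Ideal.pow_le_pow_right hle)).comp (F n) = F m := by
    intro m n hle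
    refine AlgHom.ext fun f ↦ ?_
    rw [AlgHom.comp_apply, hF, hF]
    exact (htr m _).symm.trans (by rw [trunc_trunc_of_le f hle])
  refine ⟨IsAdicComplete.liftAlgHom I F hcomp, ?_⟩
  apply IsHausdorff.funext' I (f := fun _ : Unit ↦ _) (g := fun _ : Unit ↦ x) _ |>
    fun h ↦ congrFun h ()
  intro n _
  rw [IsAdicComplete.mk_liftAlgHom, hF]
  have := htr n Polynomial.X
  rwa [Polynomial.coe_X, Polynomial.aeval_X] at this

/-- A regular local ring of dimension at most one has a principal maximal ideal. -/
theorem IsRegularLocalRing.exists_maximalIdeal_le_span {R : Type*} [CommRing R]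
    [IsRegularLocalRing R] (h : ringKrullDim R ≤ 1) :
    ∃ x ∈ maximalIdeal R, maximalIdeal R ≤ Ideal.span {x} := by
  have hfg : (maximalIdeal R).FG := IsNoetherian.noetherian _
  have h1 : (maximalIdeal R).generators.ncard ≤ 1 := by
    rw [Submodule.FG.generators_ncard hfg]
    have := (isRegularLocalRing_iff R).mp inferInstance
    rw [← this] at h
    exact_mod_cast h
  have hspan : Submodule.span R (maximalIdeal R).generators = maximalIdeal R :=
    Submodule.span_generators _
  rcases (Set.ncard_le_one_iff_eq (Submodule.FG.finite_generators hfg)).mp h1 with h2 | ⟨x, h2⟩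
  · refine ⟨0, zero_mem _, ?_⟩
    rw [← hspan, h2]
    simp
  · refine ⟨x, ?_, ?_⟩
    · rw [← hspan, h2]; exact Submodule.mem_span_singleton_self x
    · rw [← hspan, h2]

section

variable {A : Type u} {A' : Type v} [CommRing A] [IsLocalRing A] [IsArtinianRing A]
  [CommRing A'] [IsLocalRing A'] [IsNoetherianRing A'] [Algebra A A']

-- The trivial extension of the residue field of `A` already shows that `A'/𝔪A'` is regular. Its
-- dimension is at most one, so its maximal ideal is principal; lift a generator.
omit [IsNoetherianRing A'] in
theorem IsRegularMorphism.exists_maximalIdeal_le (hreg : IsRegularMorphism A A')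
    (hdim : ringKrullDim A' = 1) : ∃ x ∈ maximalIdeal A',
      maximalIdeal A' ≤ (maximalIdeal A).map (algebraMap A A') ⊔ Ideal.span {x} := by
  let m := maximalIdeal A
  let J := m.map (algebraMap A A')
  have hJ : J ≤ maximalIdeal A' := Ideal.map_le_iff_le_comap.mpr fun a ha hu ↦
    ha (isUnit_of_map_unit (algebraMap A A') a hu)
  have hJtop : J ≠ ⊤ := fun h ↦ (maximalIdeal.isMaximal A').ne_top (top_le_iff.mp (h ▸ hJ))
  have : Nontrivial (A' ⧸ J) := Ideal.Quotient.nontrivial_iff.mpr hJtop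
  have : IsLocalRing (A' ⧸ J) := .of_surjective' (Ideal.Quotient.mk J) Ideal.Quotient.mk_surjective
  have h1 := hreg.geometricallyRegular_fiber m m.ResidueField
  have h1' : IsRegularRing (m.Fiber A') := .of_ringEquiv
    (R := m.ResidueField ⊗[m.ResidueField] m.Fiber A')
    (Algebra.TensorProduct.lid m.ResidueField (m.Fiber A')).toRingEquiv
  let e₀ : (A ⧸ m) ≃ₐ[A] m.ResidueField := AlgEquiv.ofBijective
    (IsScalarTower.toAlgHom A (A ⧸ m) m.ResidueField) m.bijective_algebraMap_quotient_residueField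
  have h1'' : IsRegularRing ((A ⧸ m) ⊗[A] A') := .of_ringEquiv
    (Algebra.TensorProduct.congr e₀.symm (AlgEquiv.refl (R := A) (A₁ := A'))).toRingEquiv
  have h1''' : IsRegularRing (A' ⊗[A] (A ⧸ m)) := .of_ringEquiv
    (Algebra.TensorProduct.comm A (A ⧸ m) A').toRingEquiv
  have h2 : IsRegularRing (A' ⧸ J) := .of_ringEquiv
    (Algebra.TensorProduct.quotIdealMapEquivTensorQuot A' m).symm.toRingEquiv
  have h3 : IsRegularLocalRing (A' ⧸ J) := .of_isRegularRing_of_isLocalRing _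
  obtain ⟨y, hy, hy'⟩ := IsRegularLocalRing.exists_maximalIdeal_le_span
    (R := A' ⧸ J) ((ringKrullDim_quotient_le J).trans hdim.le)
  obtain ⟨x, rfl⟩ := Ideal.Quotient.mk_surjective y
  have hloc : IsLocalHom (Ideal.Quotient.mk J) :=
    IsLocalHom.of_surjective _ Ideal.Quotient.mk_surjective
  refine ⟨x, ?_, fun a ha ↦ ?_⟩
  · exact fun hu ↦ hy (hu.map (Ideal.Quotient.mk J))
  · have : Ideal.Quotient.mk J a ∈ maximalIdeal (A' ⧸ J) := fun hu ↦ ha (hloc.map_nonunit a hu)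
    obtain ⟨b, hb⟩ := Ideal.mem_span_singleton'.mp (hy' this)
    obtain ⟨b, rfl⟩ := Ideal.Quotient.mk_surjective b
    rw [← map_mul, eq_comm, Ideal.Quotient.eq] at hb
    rw [← sub_add_cancel a (b * x)]
    exact Submodule.add_mem_sup hb (Ideal.mem_span_singleton'.mpr ⟨b, rfl⟩)

omit [IsLocalRing A'] [IsNoetherianRing A'] in
theorem isNilpotent_map_maximalIdeal :
    IsNilpotent ((maximalIdeal A).map (algebraMap A A')) := by
  obtain ⟨n, hn⟩ := IsArtinianRing.isNilpotent_jacobson_bot (R := A)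
  rw [jacobson_eq_maximalIdeal _ bot_ne_top] at hn
  refine ⟨n, ?_⟩
  rw [← Ideal.map_pow, hn]
  simp

-- Otherwise every prime of `A'` would contain both `x` and the nilpotent ideal `𝔪A'`, hence be
-- maximal, and the dimension would be zero.
omit [IsNoetherianRing A'] in
theorem not_isNilpotent_of_maximalIdeal_le (hdim : ringKrullDim A' = 1) {x : A'}
    (hx : maximalIdeal A' ≤ (maximalIdeal A).map (algebraMap A A') ⊔ Ideal.span {x}) :
    ¬ IsNilpotent x := by
  intro hn
  have h0 : Ring.KrullDimLE 0 A' := .mk₀ fun p hp ↦ by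
    have h1 : maximalIdeal A' ≤ p := by
      refine hx.trans (sup_le ?_ ?_)
      · obtain ⟨n, hn⟩ := isNilpotent_map_maximalIdeal (A := A) (A' := A')
        exact hp.le_of_pow_le (n := n) (hn.trans_le bot_le)
      · rw [Ideal.span_singleton_le_iff_mem]
        obtain ⟨n, hn⟩ := hn
        exact hp.mem_of_pow_mem n (hn ▸ zero_mem p)
    rw [← (maximalIdeal.isMaximal A').eq_of_le hp.ne_top h1]
    exact maximalIdeal.isMaximal A'
  rw [Ring.krullDimLE_iff, hdim] at h0
  exact absurd h0 (by norm_num)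

end

/-- Nakayama's lemma for a nilpotent ideal. -/
theorem Submodule.eq_top_of_sup_smul_top_eq_top {R M : Type*} [CommRing R] [AddCommGroup M]
    [Module R M] {I : Ideal R} (hI : IsNilpotent I) {N : Submodule R M}
    (hN : N ⊔ I • (⊤ : Submodule R M) = ⊤) : N = ⊤ := by
  have h : ∀ n, N ⊔ I ^ n • (⊤ : Submodule R M) = ⊤ := by
    intro n
    induction n with
    | zero => simp
    | succ n ih =>
      refine top_le_iff.mp (ih.ge.trans (sup_le le_sup_left ?_))
      have h1 : I ^ n • (⊤ : Submodule R M) = I ^ n • N ⊔ I ^ (n + 1) • (⊤ : Submodule R M) := by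
        rw [← hN, Submodule.smul_sup, hN, ← mul_smul, ← pow_succ]
      rw [h1]
      exact sup_le_sup_right (Submodule.smul_le.mpr fun r _ m hm ↦ N.smul_mem r hm) _
  obtain ⟨n, hn⟩ := hI
  have h3 := h n
  rwa [hn, zero_smul, Submodule.zero_eq_bot, sup_bot_eq] at h3

section

variable {A : Type u} {A' : Type v} [CommRing A] [IsLocalRing A] [IsArtinianRing A]
  [CommRing A'] [IsLocalRing A'] [IsNoetherianRing A'] [Algebra A A']
  {k : Type u} [Field k] [Algebra k A] [Algebra k A'] [IsScalarTower k A A']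

omit [IsNoetherianRing A'] in
theorem exists_sub_algebraMap_mem_maximalIdeal
    (hk : Function.Surjective ((residue A).comp (algebraMap k A)))
    (hres : Function.Surjective (ResidueField.map (algebraMap A A'))) (a : A') :
    ∃ c : k, a - algebraMap k A' c ∈ maximalIdeal A' := by
  obtain ⟨b, hb⟩ := hres (residue A' a)
  obtain ⟨c, rfl⟩ := hk b
  refine ⟨c, ?_⟩
  rw [← residue_eq_zero_iff, map_sub, ← hb, RingHom.comp_apply, ResidueField.map_residue,
    IsScalarTower.algebraMap_apply k A A', sub_self]

/-- Modulo the maximal ideal of `A`, every element of `A'` is a power series in `x`. -/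
theorem exists_powerSeries_sub_mem {J : Ideal A'}
    (hsec : ∀ a : A', ∃ c : k, a - algebraMap k A' c ∈ maximalIdeal A') {x : A'}
    (hxm : x ∈ maximalIdeal A') (hx : maximalIdeal A' ≤ J ⊔ Ideal.span {x})
    (ψ : PowerSeries k →ₐ[k] A') (hψ : ψ PowerSeries.X = x) (a : A') :
    ∃ f : PowerSeries k, a - ψ f ∈ J := by
  have hstep : ∀ a : A', ∃ (c : k) (b : A'), a - algebraMap k A' c - x * b ∈ J := by
    intro a
    obtain ⟨c, hc⟩ := hsec a
    obtain ⟨y, hy, z, hz, hyz⟩ := Submodule.mem_sup.mp (hx hc)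
    obtain ⟨b, rfl⟩ := Ideal.mem_span_singleton.mp hz
    exact ⟨c, b, by rw [← hyz, add_sub_cancel_right]; exact hy⟩
  choose c b hcb using hstep
  -- The digits of `a` in base `x`: `c` picks the residue and `b` the next quotient. Krull's
  -- intersection theorem in `A'/J` then shows that nothing is left over.
  let f : PowerSeries k := .mk fun n ↦ c (b^[n] a)
  have hind : ∀ n, a - Polynomial.aeval x (f.trunc n) - x ^ n * b^[n] a ∈ J := by
    intro n
    induction n with
    | zero => simp [PowerSeries.trunc_zero']
    | succ n ih =>
      have h1 := J.add_mem ih (J.mul_mem_left (x ^ n) (hcb (b^[n] a)))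
      convert h1 using 1
      rw [PowerSeries.trunc_succ, map_add, Polynomial.aeval_monomial, Function.iterate_succ_apply',
        PowerSeries.coeff_mk]
      ring
  have hψx : ∀ p : k[X], ψ (p : PowerSeries k) = Polynomial.aeval x p := fun p ↦ by
    have h1 : ψ.comp (Polynomial.coeToPowerSeries.algHom k) = Polynomial.aeval x := by
      ext
      simp [hψ]
    rw [← h1]
    simp
  refine ⟨f, ?_⟩
  rw [← Ideal.Quotient.eq_zero_iff_mem]
  have hH : IsHausdorff (maximalIdeal A') (A' ⧸ J) :=
    IsHausdorff.of_isLocalRing _ _ (maximalIdeal.isMaximal A').ne_top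
  refine hH.haus _ fun n ↦ ?_
  obtain ⟨g, hg⟩ := PowerSeries.exists_eq_trunc_add n f
  rw [SModEq.zero]
  have h2 : a - ψ f = (a - Polynomial.aeval x (f.trunc n) - x ^ n * b^[n] a) +
      x ^ n * (b^[n] a - ψ g) := by
    conv_lhs => rw [hg]
    rw [map_add, map_mul, map_pow, hψ, hψx]
    ring
  rw [h2, map_add, Ideal.Quotient.eq_zero_iff_mem.mpr (hind n), zero_add]
  have h3 : Ideal.Quotient.mk J (x ^ n * (b^[n] a - ψ g)) =
      x ^ n • Ideal.Quotient.mk J (b^[n] a - ψ g) := rfl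
  rw [h3]
  exact Submodule.smul_mem_smul (Ideal.pow_mem_pow hxm n) trivial

/-- A complete regular `A`-algebra of dimension one with trivial residue field extension is a ring
of power series over `A`, if `A` contains its residue field. -/
theorem IsRegularMorphism.exists_bijective_powerSeries (hreg : IsRegularMorphism A A')
    [IsAdicComplete (maximalIdeal A') A'] (hdim : ringKrullDim A' = 1)
    (hk : Function.Surjective ((residue A).comp (algebraMap k A)))
    (hres : Function.Surjective (ResidueField.map (algebraMap A A'))) :
    ∃ Φ : A ⊗[k] PowerSeries k →ₐ[A] A', Function.Bijective Φ := by
  obtain ⟨x, hxm, hx⟩ := hreg.exists_maximalIdeal_le hdim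
  have hxnil := not_isNilpotent_of_maximalIdeal_le hdim hx
  obtain ⟨ψ, hψ⟩ := PowerSeries.exists_algHom_X_eq (k := k) (maximalIdeal A') hxm
  let m := maximalIdeal A
  let J := m.map (algebraMap A A')
  have hJnil : IsNilpotent J := isNilpotent_map_maximalIdeal
  let Φ : A ⊗[k] PowerSeries k →ₐ[A] A' := Algebra.TensorProduct.lift (Algebra.ofId A A') ψ
    fun _ _ ↦ Commute.all _ _
  have hΦ : ∀ a f, Φ (a ⊗ₜ f) = a • ψ f := fun a f ↦ by
    simp [Φ, Algebra.smul_def, Algebra.ofId_apply]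
  -- A nonzero `f` is a unit times `X ^ n`, so `x ^ n` would lie in the nilpotent ideal `J`,
  -- although `x` is not nilpotent.
  have hψJ : ∀ f, ψ f ∈ J → f = 0 := by
    intro f hf
    by_contra hf0
    obtain ⟨n, w, hw⟩ := IsDiscreteValuationRing.associated_pow_irreducible hf0
      PowerSeries.X_irreducible
    obtain ⟨N, hN⟩ := hJnil
    refine hxnil ⟨n * N, ?_⟩
    have h1 : x ^ n ∈ J := by
      rw [← hψ, ← map_pow, ← hw, map_mul]
      exact J.mul_mem_right _ hf
    have h2 := Ideal.pow_mem_pow h1 N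
    rw [hN] at h2
    rw [pow_mul]
    exact h2
  refine ⟨Φ, ?_, ?_⟩
  · have := hreg.flat
    let e := Module.Free.chooseBasis k (PowerSeries k)
    -- Injectivity: by flatness over the Artinian local ring `A`, independence can be checked on the
    -- closed fibre, where it follows from `hψJ`.
    have hli : LinearIndependent A (fun i ↦ ψ (e i)) := by
      apply Module.IsLocalRing.linearIndependent_of_flat
      rw [linearIndependent_iff']
      intro s c hc
      have hck : ∀ i, ∃ d : k, residue A (algebraMap k A d) = c i := fun i ↦ hk (c i)
      choose d hd using hck
      have h1 : TensorProduct.mk A (ResidueField A) A' 1 (ψ (∑ i ∈ s, d i • e i)) = 0 := by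
        rw [← hc, map_sum, map_sum]
        refine Finset.sum_congr rfl fun i _ ↦ ?_
        rw [map_smul, ← hd, ← algebraMap_smul A (d i), map_smul]
        exact (algebraMap_smul (ResidueField A) (algebraMap k A (d i)) _).symm
      have h2 : ψ (∑ i ∈ s, d i • e i) ∈ J := by
        have : ψ (∑ i ∈ s, d i • e i) ∈ LinearMap.ker (TensorProduct.mk A (A ⧸ m) A' 1) := h1
        rw [LinearMap.ker_tensorProductMk, Ideal.smul_top_eq_map] at this
        exact this
      have h3 := linearIndependent_iff'.mp e.linearIndependent s d (hψJ _ h2)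
      intro i hi
      rw [← hd, h3 i hi, map_zero, map_zero]
    rw [injective_iff_map_eq_zero]
    intro z hz
    let eA := Algebra.TensorProduct.basis A e
    apply eA.repr.map_eq_zero_iff.mp
    apply linearIndependent_iff.mp hli
    rw [← hz]
    conv_rhs => rw [← eA.linearCombination_repr z]
    rw [← AlgHom.coe_toLinearMap Φ, Finsupp.apply_linearCombination]
    congr 2
    ext i
    simp [eA, hΦ]
  · rw [← AlgHom.coe_toLinearMap, ← LinearMap.range_eq_top]
    have h1 : LinearMap.range Φ.toLinearMap ⊔ m • (⊤ : Submodule A A') = ⊤ := by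
      rw [eq_top_iff]
      intro a _
      obtain ⟨f, hf⟩ := exists_powerSeries_sub_mem
        (exists_sub_algebraMap_mem_maximalIdeal hk hres) hxm hx ψ hψ a
      rw [← add_sub_cancel (ψ f) a]
      refine Submodule.add_mem_sup ⟨1 ⊗ₜ f, by simp [hΦ]⟩ ?_
      rw [Ideal.smul_top_eq_map]
      exact hf
    refine Submodule.eq_top_of_sup_smul_top_eq_top (I := m) ?_ h1
    change IsNilpotent (maximalIdeal A)
    rw [← jacobson_eq_maximalIdeal (⊥ : Ideal A) bot_ne_top]
    exact IsArtinianRing.isNilpotent_jacobson_bot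

end

/-! ### Reduction to finitely many power series -/

/-- A tensor is a finite sum of pure ones. The set `T` is independent of `C`, so `C` can be chosen
afterwards for all generators of `B` at once. -/
theorem TensorProduct.exists_finset_forall_mem_range {k A V : Type*} [CommRing k] [CommRing A]
    [Algebra k A] [CommRing V] [Algebra k V] (z : A ⊗[k] V) :
    ∃ T : Finset V, ∀ C : Subalgebra k V, (∀ t ∈ T, t ∈ C) →
      z ∈ (Algebra.TensorProduct.map (AlgHom.id A A) C.val).range := by
  classical
  induction z using TensorProduct.induction_on with
  | zero => exact ⟨∅, fun _ _ ↦ zero_mem _⟩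
  | tmul a v =>
    exact ⟨{v}, fun C hC ↦ ⟨a ⊗ₜ ⟨v, hC v (Finset.mem_singleton_self v)⟩, by simp⟩⟩
  | add x y hx hy =>
    obtain ⟨T, hT⟩ := hx
    obtain ⟨T', hT'⟩ := hy
    exact ⟨T ∪ T', fun C hC ↦ add_mem (hT C fun t ht ↦ hC t (Finset.mem_union_left _ ht))
      (hT' C fun t ht ↦ hC t (Finset.mem_union_right _ ht))⟩

end

theorem theorem3
    (A : Type u) [CommRing A] [IsLocalRing A] [IsArtinianRing A]
    -- `A` contains its residue field
    (hk : ∃ σ : IsLocalRing.ResidueField A →+* A,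
      (IsLocalRing.residue A).comp σ = RingHom.id (IsLocalRing.ResidueField A))
    (A' : Type v) [CommRing A'] [IsLocalRing A'] [IsNoetherianRing A']
    [IsAdicComplete (IsLocalRing.maximalIdeal A') A']
    (hdim : ringKrullDim A' = 1)
    [Algebra A A']
    -- `A'` has the same residue field as `A`
    (hres : Function.Bijective (IsLocalRing.ResidueField.map (algebraMap A A')))
    (hreg : IsRegularMorphism A A')
    (B : Type w) [CommRing B] [Algebra A B] [Algebra.FiniteType A B]
    (f : B →ₐ[A] A') :
    ∃ (C : Type u) (_ : CommRing C) (_ : Algebra A C),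
      Algebra.Smooth A C ∧ ∃ (g : B →ₐ[A] C) (h : C →ₐ[A] A'), h.comp g = f := by
  classical
  obtain ⟨σ, hσ⟩ := hk
  let k := IsLocalRing.ResidueField A
  let : Algebra k A := σ.toAlgebra
  let : Algebra k A' := ((algebraMap A A').comp σ).toAlgebra
  have : IsScalarTower k A A' := .of_algebraMap_eq fun _ ↦ rfl
  have hk : Function.Surjective ((IsLocalRing.residue A).comp (algebraMap k A)) := by
    change Function.Surjective ((IsLocalRing.residue A).comp σ)
    rw [hσ]
    exact Function.surjective_id
  obtain ⟨Φ, hΦ⟩ := hreg.exists_bijective_powerSeries hdim hk hres.2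
  let e := AlgEquiv.ofBijective Φ hΦ
  obtain ⟨s, hs⟩ := ‹Algebra.FiniteType A B›
  choose T hT using fun b : B ↦ TensorProduct.exists_finset_forall_mem_range (e.symm (f b))
  obtain ⟨C, hC, hTC⟩ := exists_smooth_subalgebra_powerSeries (s.biUnion T)
  let ι : A ⊗[k] C →ₐ[A] A ⊗[k] PowerSeries k :=
    Algebra.TensorProduct.map (AlgHom.id A A) C.val
  -- Flatness of `A` over the field `k`; it lets the map from `B` be lifted through `ι` once its
  -- image lies in the range.
  have hι : Function.Injective ι :=
    Module.Flat.lTensor_preserves_injective_linearMap C.val.toLinearMap Subtype.val_injective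
  have hrange : ∀ b, e.symm (f b) ∈ ι.range := by
    intro b
    have h1 : Algebra.adjoin A (s : Set B) ≤ ι.range.comap (e.symm.toAlgHom.comp f) :=
      Algebra.adjoin_le fun b hb ↦ hT b C fun t ht ↦ hTC t (Finset.mem_biUnion.mpr ⟨b, hb, ht⟩)
    rw [hs] at h1
    exact h1 trivial
  refine ⟨A ⊗[k] C, inferInstance, inferInstance, inferInstance,
    (AlgEquiv.ofInjective ι hι).symm.toAlgHom.comp
      ((e.symm.toAlgHom.comp f).codRestrict ι.range hrange), e.toAlgHom.comp ι, ?_⟩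
  ext b
  have h2 := congrArg Subtype.val
    ((AlgEquiv.ofInjective ι hι).apply_symm_apply ⟨e.symm (f b), hrange b⟩)
  exact (congrArg e h2).trans (e.apply_symm_apply (f b))
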